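/- Let $K$ be a field and let $L$ be a finite-dimensional nilpotent Lie algebra over $K$ with $\dim L=n$ and $\dim L^2=m\ge 1$, where $L^2=[L,L]$. Let $M(L)=(R\cap [F,F])/[F,R]$ be the Schur multiplier of $L$, where $0\to R\to F\to L\to 0$ is a presentation of $L$ with $F$ a free Lie algebra over $K$ (up to isomorphism, $M(L)$ does not depend on the presentation; to be definite, let $F$ be the free Lie algebra on the underlying set of $L$, mapped to $L$ by sending each generator to itself). Then $M(L)$ is finite-dimensional and $$\dim M(L)\le \tfrac12(n+m-2)(n-m-1)+1.$$ Moreover, if $m=1$, then equality holds if and only if $L\cong H(1)\oplus A$ for some abelian Lie algebra $A$ over $K$ with $\dim A=n-3$, where $H(1)$ is the Heisenberg algebra of dimension $3$, that is, the Lie algebra with basis $v_1,v_2,v$ whose only non-zero brackets of basis elements are $[v_1,v_2]=-[v_2,v_1]=v$. -/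

import Mathlib

universe u v

section Multiplier

variable (K : Type*) (L : Type*) [Field K] [LieRing L] [LieAlgebra K L]

/-- The standard free presentation of a Lie algebra `L`: the homomorphism from the free Lie algebra
on the underlying set of `L` onto `L` that sends each generator to itself. -/
noncomputable def freePresentation : FreeLieAlgebra K L →ₗ⁅K⁆ L :=
  FreeLieAlgebra.lift K (fun x : L => x)

theorem freePresentation_surjective : Function.Surjective (freePresentation K L) := fun x =>
  ⟨FreeLieAlgebra.of K x, by simp [freePresentation]⟩

/-- The Schur multiplier of `L`, that is `(R ∩ F²) / [F, R]`, where `F` is the free Lie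
algebra on `L` and `R` is the kernel of the standard free presentation `F → L` (up to isomorphism,
the quotient does not depend on the choice of a free presentation). It is an abelian Lie algebra,
so only its vector space structure is kept. -/
abbrev SchurMultiplier : Type _ :=
  ↥((freePresentation K L).ker ⊓ ⁅(⊤ : LieIdeal K (FreeLieAlgebra K L)),
      (⊤ : LieIdeal K (FreeLieAlgebra K L))⁆).toSubmodule ⧸
    (⁅(⊤ : LieIdeal K (FreeLieAlgebra K L)), (freePresentation K L).ker⁆).toSubmodule.submoduleOf
      ((freePresentation K L).ker ⊓ ⁅(⊤ : LieIdeal K (FreeLieAlgebra K L)),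
        (⊤ : LieIdeal K (FreeLieAlgebra K L))⁆).toSubmodule

end Multiplier

section Heisenberg

/-- The underlying space of the Heisenberg algebra `H(m)` of dimension `2m + 1`. The element
`⟨a, b, c⟩` stands for `∑ i, (a i • v_{2i-1} + b i • v_{2i}) + c • v`. -/
@[ext] structure HeisenbergAlgebra (K : Type*) (m : ℕ) where
  a : Fin m → K
  b : Fin m → K
  c : K

namespace HeisenbergAlgebra

/-- The identification with coordinate space, which gives the vector space structure. -/
def equivProd (K : Type*) (m : ℕ) :
    HeisenbergAlgebra K m ≃ (Fin m → K) × (Fin m → K) × K where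
  toFun x := (x.a, x.b, x.c)
  invFun p := ⟨p.1, p.2.1, p.2.2⟩

variable {K : Type*} [Field K] {m : ℕ}

instance : AddCommGroup (HeisenbergAlgebra K m) := (equivProd K m).addCommGroup

instance : Module K (HeisenbergAlgebra K m) := (equivProd K m).module K

/-- The bracket is the bilinear one with `[v_{2i-1}, v_{2i}] = -[v_{2i}, v_{2i-1}] = v` for each `i`
in which all other brackets of basis elements vanish. -/
instance : Bracket (HeisenbergAlgebra K m) (HeisenbergAlgebra K m) where
  bracket x y := ⟨0, 0, ∑ i, (x.a i * y.b i - x.b i * y.a i)⟩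

@[simp] theorem bracket_a (x y : HeisenbergAlgebra K m) : ⁅x, y⁆.a = 0 := rfl
@[simp] theorem bracket_b (x y : HeisenbergAlgebra K m) : ⁅x, y⁆.b = 0 := rfl
@[simp] theorem bracket_c (x y : HeisenbergAlgebra K m) :
    ⁅x, y⁆.c = ∑ i, (x.a i * y.b i - x.b i * y.a i) := rfl
@[simp] theorem add_a (x y : HeisenbergAlgebra K m) : (x + y).a = x.a + y.a := rfl
@[simp] theorem add_b (x y : HeisenbergAlgebra K m) : (x + y).b = x.b + y.b := rfl
@[simp] theorem add_c (x y : HeisenbergAlgebra K m) : (x + y).c = x.c + y.c := rfl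
@[simp] theorem smul_a (t : K) (x : HeisenbergAlgebra K m) : (t • x).a = t • x.a := rfl
@[simp] theorem smul_b (t : K) (x : HeisenbergAlgebra K m) : (t • x).b = t • x.b := rfl
@[simp] theorem smul_c (t : K) (x : HeisenbergAlgebra K m) : (t • x).c = t • x.c := rfl
@[simp] theorem zero_a : (0 : HeisenbergAlgebra K m).a = 0 := rfl
@[simp] theorem zero_b : (0 : HeisenbergAlgebra K m).b = 0 := rfl
@[simp] theorem zero_c : (0 : HeisenbergAlgebra K m).c = 0 := rfl

instance : LieRing (HeisenbergAlgebra K m) where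
  add_lie x y z := by
    refine HeisenbergAlgebra.ext (by simp) (by simp) ?_
    simp only [bracket_c, add_a, add_b, add_c, Pi.add_apply,
      ← Finset.sum_add_distrib]
    exact Finset.sum_congr rfl fun i _ => by ring
  lie_add x y z := by
    refine HeisenbergAlgebra.ext (by simp) (by simp) ?_
    simp only [bracket_c, add_a, add_b, add_c, Pi.add_apply,
      ← Finset.sum_add_distrib]
    exact Finset.sum_congr rfl fun i _ => by ring
  lie_self x := HeisenbergAlgebra.ext (by simp) (by simp) (by simp [mul_comm])
  leibniz_lie x y z := HeisenbergAlgebra.ext (by simp) (by simp) (by simp)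

instance : LieAlgebra K (HeisenbergAlgebra K m) where
  lie_smul t x y := by
    refine HeisenbergAlgebra.ext (by simp) (by simp) ?_
    simp only [bracket_c, smul_a, smul_b, smul_c, Pi.smul_apply, smul_eq_mul,
      Finset.mul_sum]
    exact Finset.sum_congr rfl fun i _ => by ring

end HeisenbergAlgebra

end Heisenberg

/-! Write F²/[F,R] for the derived algebra of the universal central extension F/[F,R]. Brackets in
it depend only on images in L, so a linear form on it amounts to an alternating 2-cocycle on L with
trivial coefficients. Since M(L) is the kernel of F²/[F,R] → L², dim M(L) + m = dim Z²(L,K)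
(`finrank_schurMultiplier_add_finrank_derived`), and the problem becomes one about cocycles.

To bound Z², enlarge a subspace I of L² from 0, one vector v at a time, each central modulo I. For a
cocycle ω with I in its radical, ω(v,·) kills L², so each step costs at most n-m dimensions
(`finrank_cocyclesVanishingOn_le_add`). When I has codimension 1 in L², some v = [x,y] spans L²
modulo I, and the cocycle identity makes ω(v,·) vanish once ω(v,x) and ω(v,y) do. Only 2 dimensions
are lost, and forms on L/L² remain (`finrank_cocyclesVanishingOn_eq`). Hence dim Z² ≤ (m-1)(n-m) + 2
+ C(n-m,2).

For m = 1, equality means that the pair (ω(v,x), ω(v,y)) takes all values. Cocycles with values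
(1,0) and (0,1) then give forms α, β with [z,w] = (α∧β)(z,w) v, which splits off H(1); conversely,
on H(1) ⊕ A the forms γ∧(sα+tβ) realise all values. -/

/-! ### 2-cocycles and the central extensions they define. -/

section Cocycles

variable (K : Type*) (L : Type*) [Field K] [LieRing L] [LieAlgebra K L]

/-- The space of alternating 2-cocycles on `L` with values in the trivial module `K`. -/
def trivialTwoCocycles : Submodule K (L →ₗ[K] L →ₗ[K] K) where
  carrier := {ω | (∀ x, ω x x = 0) ∧ ∀ x y z, ω ⁅x, y⁆ z + ω ⁅y, z⁆ x + ω ⁅z, x⁆ y = 0}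
  zero_mem' := by simp
  add_mem' := by
    rintro ω η ⟨h1, h2⟩ ⟨h3, h4⟩
    refine ⟨fun x => by simp [h1, h3], fun x y z => ?_⟩
    simp only [LinearMap.add_apply]
    linear_combination h2 x y z + h4 x y z
  smul_mem' := by
    rintro t ω ⟨h1, h2⟩
    refine ⟨fun x => by simp [h1], fun x y z => ?_⟩
    simp only [LinearMap.smul_apply, smul_eq_mul]
    linear_combination t * h2 x y z

variable {K L}

theorem LinearMap.skew_of_apply_self_eq_zero {V : Type*} [AddCommGroup V] [Module K V]
    {ω : V →ₗ[K] V →ₗ[K] K} (h : ∀ x, ω x x = 0) (x y : V) : ω x y = -ω y x := by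
  have := h (x + y)
  simp only [map_add, LinearMap.add_apply, h] at this
  linear_combination this

/-- The central extension of `L` by `K` defined by a 2-cocycle. -/
@[ext] structure CocycleExtension (ω : trivialTwoCocycles K L) where
  base : L
  fibre : K

namespace CocycleExtension

variable (ω : trivialTwoCocycles K L)

/-- The underlying space of the extension is a product. -/
def equivProd : CocycleExtension ω ≃ L × K where
  toFun x := (x.base, x.fibre)
  invFun p := ⟨p.1, p.2⟩

instance : AddCommGroup (CocycleExtension ω) := (equivProd ω).addCommGroup

instance : Module K (CocycleExtension ω) := (equivProd ω).module K

instance : Bracket (CocycleExtension ω) (CocycleExtension ω) where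
  bracket x y := ⟨⁅x.base, y.base⁆, ω.1 x.base y.base⟩

variable {ω}

@[simp] theorem bracket_base (x y : CocycleExtension ω) : ⁅x, y⁆.base = ⁅x.base, y.base⁆ := rfl
@[simp] theorem bracket_fibre (x y : CocycleExtension ω) :
    ⁅x, y⁆.fibre = ω.1 x.base y.base := rfl
@[simp] theorem add_base (x y : CocycleExtension ω) : (x + y).base = x.base + y.base := rfl
@[simp] theorem add_fibre (x y : CocycleExtension ω) : (x + y).fibre = x.fibre + y.fibre := rfl
@[simp] theorem smul_base (t : K) (x : CocycleExtension ω) : (t • x).base = t • x.base := rfl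
@[simp] theorem smul_fibre (t : K) (x : CocycleExtension ω) : (t • x).fibre = t • x.fibre := rfl
@[simp] theorem zero_base : (0 : CocycleExtension ω).base = 0 := rfl
@[simp] theorem zero_fibre : (0 : CocycleExtension ω).fibre = 0 := rfl

instance : LieRing (CocycleExtension ω) where
  add_lie x y z := by ext <;> simp
  lie_add x y z := by ext <;> simp
  lie_self x := by ext <;> simp [ω.2.1]
  leibniz_lie x y z := by
    ext
    · simp
    · have h := ω.2.2 x.base y.base z.base
      have h1 := LinearMap.skew_of_apply_self_eq_zero ω.2.1 x.base ⁅y.base, z.base⁆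
      have h2 := LinearMap.skew_of_apply_self_eq_zero ω.2.1 y.base ⁅x.base, z.base⁆
      have h3 : ω.1 ⁅z.base, x.base⁆ y.base = -ω.1 ⁅x.base, z.base⁆ y.base := by
        rw [← lie_skew, map_neg, LinearMap.neg_apply]
      simp only [bracket_fibre, bracket_base, add_fibre]
      linear_combination h1 - h2 - h + h3

instance : LieAlgebra K (CocycleExtension ω) where
  lie_smul t x y := by ext <;> simp

variable (ω)

/-- The projection of the extension onto `L`. -/
def proj : CocycleExtension ω →ₗ⁅K⁆ L where
  toFun := base
  map_add' _ _ := rfl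
  map_smul' _ _ := rfl
  map_lie' := rfl

/-- The projection of the extension onto `K`, which is only linear. -/
def fibreMap : CocycleExtension ω →ₗ[K] K where
  toFun := fibre
  map_add' _ _ := rfl
  map_smul' _ _ := rfl

@[simp] theorem proj_apply (x : CocycleExtension ω) : proj ω x = x.base := rfl
@[simp] theorem fibreMap_apply (x : CocycleExtension ω) : fibreMap ω x = x.fibre := rfl

/-- The lift of the standard free presentation of `L` to the extension. -/
noncomputable def lift : FreeLieAlgebra K L →ₗ⁅K⁆ CocycleExtension ω :=
  FreeLieAlgebra.lift K (fun x : L => (⟨x, 0⟩ : CocycleExtension ω))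

theorem base_lift (a : FreeLieAlgebra K L) : (lift ω a).base = freePresentation K L a := by
  have : (proj ω).comp (lift ω) = freePresentation K L := by
    ext x
    simp [lift, freePresentation]
  rw [← this]
  rfl

end CocycleExtension

end Cocycles

/-! ### The Hopf formula in terms of 2-cocycles. -/

section Hopf

/-- The derived subalgebra of the free Lie algebra on `L`. -/
noncomputable abbrev freeDerived (K L : Type*) [Field K] : Submodule K (FreeLieAlgebra K L) :=
  (⁅(⊤ : LieIdeal K (FreeLieAlgebra K L)), (⊤ : LieIdeal K (FreeLieAlgebra K L))⁆).toSubmodule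

theorem lie_mem_freeDerived {K L : Type*} [Field K] (a b : FreeLieAlgebra K L) :
    ⁅a, b⁆ ∈ freeDerived K L :=
  LieSubmodule.lie_mem_lie (LieSubmodule.mem_top a) (LieSubmodule.mem_top b)

variable (K : Type*) (L : Type*) [Field K] [LieRing L] [LieAlgebra K L]

/-- The submodule `[F, R]` of the free Lie algebra `F` on `L`, with `R` the relations of `L`. -/
noncomputable abbrev freeCommRel : Submodule K (FreeLieAlgebra K L) :=
  (⁅(⊤ : LieIdeal K (FreeLieAlgebra K L)), (freePresentation K L).ker⁆).toSubmodule

/-- The space `F² / [F, R]`, the derived subalgebra of the universal central extension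
`F / [F, R]`. -/
abbrev CoverDerived : Type _ :=
  ↥(freeDerived K L) ⧸ (freeCommRel K L).submoduleOf (freeDerived K L)

variable {K L}

theorem lie_mem_freeCommRel (a : FreeLieAlgebra K L) {b : FreeLieAlgebra K L}
    (hb : freePresentation K L b = 0) : ⁅a, b⁆ ∈ freeCommRel K L :=
  LieSubmodule.lie_mem_lie (LieSubmodule.mem_top a) (by simpa using hb)

variable (K L) in
/-- The commutator pairing of the free Lie algebra with values in `F² / [F, R]`. -/
noncomputable def coverBracket :
    FreeLieAlgebra K L →ₗ[K] FreeLieAlgebra K L →ₗ[K] CoverDerived K L :=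
  LinearMap.mk₂ K (fun a b => Submodule.Quotient.mk ⟨⁅a, b⁆, lie_mem_freeDerived a b⟩)
    (fun a b c => by simp only [← Submodule.Quotient.mk_add]; congr; simp)
    (fun t a b => by simp only [← Submodule.Quotient.mk_smul]; congr; simp)
    (fun a b c => by simp only [← Submodule.Quotient.mk_add]; congr; simp)
    (fun t a b => by simp only [← Submodule.Quotient.mk_smul]; congr; simp)

theorem coverBracket_apply (a b : FreeLieAlgebra K L) : coverBracket K L a b =
    Submodule.Quotient.mk ⟨⁅a, b⁆, lie_mem_freeDerived a b⟩ := rfl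

theorem coverBracket_self (a : FreeLieAlgebra K L) : coverBracket K L a a = 0 := by
  rw [coverBracket_apply, Submodule.Quotient.mk_eq_zero]
  simp [Submodule.submoduleOf]

theorem coverBracket_skew (a b : FreeLieAlgebra K L) :
    coverBracket K L a b = -coverBracket K L b a := by
  have := coverBracket_self (a + b)
  simp only [map_add, LinearMap.add_apply, coverBracket_self] at this
  rw [eq_neg_iff_add_eq_zero, ← this]
  abel

theorem coverBracket_right_eq_zero (a : FreeLieAlgebra K L) {b : FreeLieAlgebra K L}
    (hb : freePresentation K L b = 0) : coverBracket K L a b = 0 := by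
  rw [coverBracket_apply, Submodule.Quotient.mk_eq_zero]
  exact lie_mem_freeCommRel a hb

/-- Changing an argument by a relation changes the bracket by an element of [F,R], so the pairing
descends to L × L. -/
theorem coverBracket_congr {a a' b b' : FreeLieAlgebra K L}
    (ha : freePresentation K L a = freePresentation K L a')
    (hb : freePresentation K L b = freePresentation K L b') :
    coverBracket K L a b = coverBracket K L a' b' := by
  have h1 : coverBracket K L a b = coverBracket K L a b' := by
    rw [← sub_eq_zero, ← map_sub]
    exact coverBracket_right_eq_zero a (by rw [map_sub, hb, sub_self])
  have h2 : coverBracket K L b' a = coverBracket K L b' a' := by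
    rw [← sub_eq_zero, ← map_sub]
    exact coverBracket_right_eq_zero b' (by rw [map_sub, ha, sub_self])
  rw [h1, coverBracket_skew, h2, ← coverBracket_skew]

theorem coverBracket_jacobi (a b c : FreeLieAlgebra K L) :
    coverBracket K L ⁅a, b⁆ c + coverBracket K L ⁅b, c⁆ a + coverBracket K L ⁅c, a⁆ b = 0 := by
  simp only [coverBracket_apply, ← Submodule.Quotient.mk_add]
  rw [Submodule.Quotient.mk_eq_zero]
  have h : ⁅⁅a, b⁆, c⁆ + ⁅⁅b, c⁆, a⁆ + ⁅⁅c, a⁆, b⁆ = 0 := by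
    rw [← neg_eq_zero, ← lie_jacobi c a b, ← lie_skew ⁅a, b⁆ c, ← lie_skew ⁅b, c⁆ a,
      ← lie_skew ⁅c, a⁆ b]
    abel
  simp only [Submodule.submoduleOf, Submodule.mem_comap, Submodule.subtype_apply,
    Submodule.coe_add, h, zero_mem]

theorem coverDerived_hom_ext {V : Type*} [AddCommGroup V] [Module K V]
    {f g : CoverDerived K L →ₗ[K] V}
    (h : ∀ a b, f (coverBracket K L a b) = g (coverBracket K L a b)) : f = g := by
  refine Submodule.linearMap_qext _ (LinearMap.ext fun x => ?_)
  obtain ⟨x, hx⟩ := x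
  have hx' := hx
  rw [freeDerived, LieSubmodule.lieIdeal_oper_eq_linear_span'] at hx'
  induction hx' using Submodule.span_induction with
  | mem x hx' =>
    obtain ⟨a, -, b, -, rfl⟩ := hx'
    exact h a b
  | zero => exact (map_zero _).trans (map_zero _).symm
  | add x y hx' hy' h1 h2 =>
    rw [← LieSubmodule.lieIdeal_oper_eq_linear_span'] at hx' hy'
    have := congrArg₂ (· + ·) (h1 hx') (h2 hy')
    simp only [← map_add] at this
    exact this
  | smul t x hx' h1 =>
    rw [← LieSubmodule.lieIdeal_oper_eq_linear_span'] at hx'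
    have := congrArg (t • ·) (h1 hx')
    simp only [← map_smul] at this
    exact this

variable (K L) in
/-- A linear form on `F² / [F, R]` gives a 2-cocycle on `L`. -/
noncomputable def dualCoverToCocycle :
    Module.Dual K (CoverDerived K L) →ₗ[K] trivialTwoCocycles K L where
  toFun f := ⟨LinearMap.mk₂ K
      (fun x y => f (coverBracket K L (FreeLieAlgebra.of K x) (FreeLieAlgebra.of K y)))
      (fun x y z => by
        rw [← map_add, ← LinearMap.add_apply, ← map_add]
        congr 1
        exact coverBracket_congr (by simp [freePresentation]) rfl)
      (fun t x y => by
        rw [← map_smul, ← LinearMap.smul_apply, ← map_smul]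
        congr 1
        exact coverBracket_congr (by simp [freePresentation]) rfl)
      (fun x y z => by
        rw [← map_add, ← map_add]
        congr 1
        exact coverBracket_congr rfl (by simp [freePresentation]))
      (fun t x y => by
        rw [← map_smul, ← map_smul]
        congr 1
        exact coverBracket_congr rfl (by simp [freePresentation])),
    fun x => by simp [coverBracket_self],
    fun x y z => by
      simp only [LinearMap.mk₂_apply]
      have h := congrArg f (coverBracket_jacobi (FreeLieAlgebra.of K x) (FreeLieAlgebra.of K y)
        (FreeLieAlgebra.of K z))
      have h' (p q r : L) : coverBracket K L (FreeLieAlgebra.of K ⁅p, q⁆) (FreeLieAlgebra.of K r) =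
          coverBracket K L ⁅FreeLieAlgebra.of K p, FreeLieAlgebra.of K q⁆
            (FreeLieAlgebra.of K r) :=
        coverBracket_congr (by simp [freePresentation]) rfl
      rw [h', h', h']
      simpa using h⟩
  map_add' f g := by ext; simp
  map_smul' t f := by ext; simp

theorem dualCoverToCocycle_apply (f : Module.Dual K (CoverDerived K L)) (x y : L) :
    (dualCoverToCocycle K L f).1 x y =
      f (coverBracket K L (FreeLieAlgebra.of K x) (FreeLieAlgebra.of K y)) := rfl

/-- Brackets of generators already span F²/[F,R], because each element of F may be replaced by the
generator named by its image in L. -/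
theorem dualCoverToCocycle_injective : Function.Injective (dualCoverToCocycle K L) := by
  intro f g h
  refine coverDerived_hom_ext fun a b => ?_
  have : coverBracket K L a b = coverBracket K L (FreeLieAlgebra.of K (freePresentation K L a))
      (FreeLieAlgebra.of K (freePresentation K L b)) :=
    coverBracket_congr (by simp [freePresentation]) (by simp [freePresentation])
  rw [this, ← dualCoverToCocycle_apply, h, dualCoverToCocycle_apply]

/-- Lift F → L to the extension defined by ω. Relations land in the central fibre, so [F,R] maps to
0, and the fibre coordinate on F² is the required form. -/
theorem dualCoverToCocycle_surjective : Function.Surjective (dualCoverToCocycle K L) := by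
  intro ω
  have key : (freeCommRel K L).submoduleOf (freeDerived K L) ≤ LinearMap.ker
      ((CocycleExtension.fibreMap ω ∘ₗ (CocycleExtension.lift ω).toLinearMap) ∘ₗ
        (freeDerived K L).subtype) := by
    rw [LinearMap.ker_comp, Submodule.submoduleOf]
    refine Submodule.comap_mono ?_
    rw [freeCommRel, LieSubmodule.lieIdeal_oper_eq_linear_span', Submodule.span_le]
    rintro _ ⟨a, -, b, hb, rfl⟩
    have hb' : freePresentation K L b = 0 := by simpa using hb
    simp [CocycleExtension.base_lift, hb']
  refine ⟨Submodule.liftQ _ _ key, ?_⟩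
  ext x y
  rw [dualCoverToCocycle_apply, coverBracket_apply]
  simp [CocycleExtension.lift]

/-- The dual embeds in a space of bilinear forms on L, and finite-dimensionality passes back from
the dual to the space. -/
theorem finiteDimensional_coverDerived [FiniteDimensional K L] :
    FiniteDimensional K (CoverDerived K L) := by
  refine (Module.finite_dual_iff K).mp ?_
  exact Module.Finite.of_injective (dualCoverToCocycle K L) dualCoverToCocycle_injective

theorem finrank_coverDerived [FiniteDimensional K L] :
    Module.finrank K (CoverDerived K L) = Module.finrank K (trivialTwoCocycles K L) := by
  rw [← Subspace.dual_finrank_eq]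
  exact (LinearEquiv.ofBijective _
    ⟨dualCoverToCocycle_injective, dualCoverToCocycle_surjective⟩).finrank_eq

variable (K L) in
/-- The inclusion of the Schur multiplier in `F² / [F, R]`. -/
noncomputable def schurMultiplierInclusion : SchurMultiplier K L →ₗ[K] CoverDerived K L :=
  Submodule.mapQ _ _ (Submodule.inclusion (show
    ((freePresentation K L).ker ⊓ ⁅(⊤ : LieIdeal K (FreeLieAlgebra K L)),
      (⊤ : LieIdeal K (FreeLieAlgebra K L))⁆).toSubmodule ≤ freeDerived K L from
        fun _ h => h.2)) (fun _ h => h)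

theorem schurMultiplierInclusion_injective :
    Function.Injective (schurMultiplierInclusion K L) := by
  rw [injective_iff_map_eq_zero]
  intro x hx
  obtain ⟨x, rfl⟩ := Submodule.Quotient.mk_surjective _ x
  have h := (Submodule.Quotient.mk_eq_zero _).mp hx
  exact (Submodule.Quotient.mk_eq_zero _).mpr h

variable (K L) in
/-- The map `F² / [F, R] → L` induced by the free presentation. -/
noncomputable def coverDerivedToBase : CoverDerived K L →ₗ[K] L :=
  Submodule.liftQ _ ((freePresentation K L).toLinearMap ∘ₗ (freeDerived K L).subtype) (by
    rw [LinearMap.ker_comp, Submodule.submoduleOf]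
    refine Submodule.comap_mono ?_
    rw [freeCommRel, LieSubmodule.lieIdeal_oper_eq_linear_span', Submodule.span_le]
    rintro _ ⟨a, -, b, hb, rfl⟩
    have hb' : freePresentation K L b = 0 := by simpa using hb
    simp [hb'])

theorem range_coverDerivedToBase : LinearMap.range (coverDerivedToBase K L) =
    (⁅(⊤ : LieIdeal K L), (⊤ : LieIdeal K L)⁆).toSubmodule := by
  rw [coverDerivedToBase, Submodule.range_liftQ, LinearMap.range_comp, Submodule.range_subtype,
    freeDerived, LieSubmodule.lieIdeal_oper_eq_linear_span',
    LieSubmodule.lieIdeal_oper_eq_linear_span', Submodule.map_span]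
  congr 1
  ext x
  constructor
  · rintro ⟨_, ⟨a, -, b, -, rfl⟩, rfl⟩
    exact ⟨_, LieSubmodule.mem_top _, _, LieSubmodule.mem_top _,
      (LieHom.map_lie (freePresentation K L) a b).symm⟩
  · rintro ⟨a, -, b, -, rfl⟩
    exact ⟨_, ⟨FreeLieAlgebra.of K a, LieSubmodule.mem_top _, FreeLieAlgebra.of K b,
      LieSubmodule.mem_top _, rfl⟩, by simp [freePresentation]⟩

theorem range_schurMultiplierInclusion :
    LinearMap.range (schurMultiplierInclusion K L) = LinearMap.ker (coverDerivedToBase K L) := by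
  ext x
  constructor
  · rintro ⟨y, rfl⟩
    obtain ⟨y, rfl⟩ := Submodule.Quotient.mk_surjective _ y
    exact LieHom.mem_ker.mp y.2.1
  · obtain ⟨x, rfl⟩ := Submodule.Quotient.mk_surjective _ x
    intro hx
    have hx' : freePresentation K L x = 0 := hx
    exact ⟨Submodule.Quotient.mk ⟨x.1, LieHom.mem_ker.mpr hx', x.2⟩, rfl⟩

theorem finiteDimensional_schurMultiplier [FiniteDimensional K L] :
    FiniteDimensional K (SchurMultiplier K L) :=
  have := finiteDimensional_coverDerived (K := K) (L := L)
  Module.Finite.of_injective (schurMultiplierInclusion K L) schurMultiplierInclusion_injective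

/-- A form of the Hopf formula: the space of 2-cocycles is an extension of the dual of the Schur
multiplier by the dual of the derived subalgebra. -/
theorem finrank_schurMultiplier_add_finrank_derived [FiniteDimensional K L] :
    Module.finrank K (SchurMultiplier K L) +
      Module.finrank K ↥⁅(⊤ : LieIdeal K L), (⊤ : LieIdeal K L)⁆ =
      Module.finrank K (trivialTwoCocycles K L) := by
  have := finiteDimensional_coverDerived (K := K) (L := L)
  rw [← finrank_coverDerived, ← LinearMap.finrank_range_add_finrank_ker (coverDerivedToBase K L),
    ← range_schurMultiplierInclusion, LinearMap.finrank_range_of_inj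
      schurMultiplierInclusion_injective, range_coverDerivedToBase, add_comm]
  rfl

end Hopf

/-! ### Dimension of the space of alternating forms with prescribed radical. -/

section AlternatingForms

variable {K V : Type*} [Field K] [AddCommGroup V] [Module K V]

/-- The alternating bilinear forms for which `W` lies in the radical. -/
def altFormsVanishingOn (W : Submodule K V) : Submodule K (V →ₗ[K] V →ₗ[K] K) where
  carrier := {ω | (∀ x, ω x x = 0) ∧ ∀ w ∈ W, ω w = 0}
  zero_mem' := by simp
  add_mem' := by
    rintro ω η ⟨h1, h2⟩ ⟨h3, h4⟩
    exact ⟨fun x => by simp [h1, h3], fun w hw => by simp [h2 w hw, h4 w hw]⟩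
  smul_mem' := by
    rintro t ω ⟨h1, h2⟩
    exact ⟨fun x => by simp [h1], fun w hw => by simp [h2 w hw]⟩

theorem vec2_update_zero {α : Type*} (x y z : α) : Function.update ![x, y] 0 z = ![z, y] := by
  ext i
  fin_cases i <;> simp

theorem vec2_update_one {α : Type*} (x y z : α) : Function.update ![x, y] 1 z = ![x, z] := by
  ext i
  fin_cases i <;> simp

variable (K V) in
/-- Alternating bilinear forms are the same as alternating maps in two variables. -/
def altFormsEquivAlternatingMap :
    altFormsVanishingOn (⊥ : Submodule K V) ≃ₗ[K] V [⋀^Fin 2]→ₗ[K] K where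
  toFun ω :=
    { toFun m := ω.1 (m 0) (m 1)
      map_update_add' m i x y := by
        fin_cases i <;> simp
      map_update_smul' m i t x := by
        fin_cases i <;> simp
      map_eq_zero_of_eq' m i j h hij := by
        fin_cases i <;> fin_cases j <;> simp_all [ω.2.1] }
  map_add' _ _ := rfl
  map_smul' _ _ := rfl
  invFun f := ⟨LinearMap.mk₂ K (fun x y => f ![x, y])
      (fun x y z => by simpa only [vec2_update_zero] using f.map_update_add ![x, z] 0 x y)
      (fun t x y => by simpa only [vec2_update_zero] using f.map_update_smul ![x, y] 0 t x)
      (fun x y z => by simpa only [vec2_update_one] using f.map_update_add ![x, y] 1 y z)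
      (fun t x y => by simpa only [vec2_update_one] using f.map_update_smul ![x, y] 1 t y),
    fun x => f.map_eq_zero_of_eq ![x, x] (i := 0) (j := 1) rfl (by simp),
    fun w hw => by
      ext y
      rw [Submodule.mem_bot] at hw
      exact f.map_coord_zero (m := ![w, y]) 0 hw⟩
  left_inv ω := by ext; simp
  right_inv f := by
    ext m
    exact congrArg f (List.ofFn_inj.mp (by simp))

theorem finrank_altForms [FiniteDimensional K V] :
    Module.finrank K (altFormsVanishingOn (⊥ : Submodule K V)) =
      (Module.finrank K V).choose 2 := by
  rw [(altFormsEquivAlternatingMap K V).finrank_eq,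
    (exteriorPower.alternatingMapLinearEquiv (R := K) (M := V) (N := K) (n := 2)).finrank_eq,
    ← exteriorPower.finrank_eq K 2]
  exact Subspace.dual_finrank_eq

theorem altFormsVanishingOn.apply_right_eq_zero {W : Submodule K V} {ω : V →ₗ[K] V →ₗ[K] K}
    (hω : ω ∈ altFormsVanishingOn W) (x : V) {w : V} (hw : w ∈ W) : ω x w = 0 := by
  rw [LinearMap.skew_of_apply_self_eq_zero hω.1, hω.2 w hw, LinearMap.zero_apply, neg_zero]

/-- The pullback of alternating forms from the quotient by `W`. -/
def altFormsPullback (W : Submodule K V) :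
    altFormsVanishingOn (⊥ : Submodule K (V ⧸ W)) →ₗ[K] altFormsVanishingOn W where
  toFun ω := ⟨ω.1.compl₁₂ W.mkQ W.mkQ, fun x => ω.2.1 _, fun w hw => by
    ext y
    simp [(Submodule.Quotient.mk_eq_zero W).mpr hw]⟩
  map_add' _ _ := rfl
  map_smul' _ _ := rfl

theorem altFormsPullback_injective (W : Submodule K V) :
    Function.Injective (altFormsPullback W) := by
  intro ω η h
  ext x y
  exact LinearMap.congr_fun₂ (congrArg Subtype.val h) x y

theorem altFormsPullback_surjective (W : Submodule K V) :
    Function.Surjective (altFormsPullback W) := by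
  intro ω
  -- Pulling back along a linear section inverts the pullback from the quotient, since s(x̄) - x
  -- lies in the radical.
  obtain ⟨s, hs⟩ := W.mkQ.exists_rightInverse_of_surjective W.range_mkQ
  have hs' (x : V) : s (W.mkQ x) - x ∈ W := by
    rw [← Submodule.Quotient.mk_eq_zero, ← Submodule.mkQ_apply, map_sub,
      ← LinearMap.comp_apply, hs, LinearMap.id_apply, sub_self]
  refine ⟨⟨ω.1.compl₁₂ s s, fun x => ω.2.1 _, by simp⟩, ?_⟩
  ext x y
  have h1 : ω.1 (s (W.mkQ x)) = ω.1 x := by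
    rw [← sub_eq_zero, ← map_sub, ω.2.2 _ (hs' x)]
  have h2 : ω.1 x (s (W.mkQ y)) = ω.1 x y := by
    rw [← sub_eq_zero, ← map_sub, altFormsVanishingOn.apply_right_eq_zero ω.2 _ (hs' y)]
  exact (LinearMap.congr_fun h1 _).trans h2

theorem finrank_altFormsVanishingOn [FiniteDimensional K V] (W : Submodule K V) :
    Module.finrank K (altFormsVanishingOn W) =
      (Module.finrank K V - Module.finrank K W).choose 2 := by
  rw [← (LinearEquiv.ofBijective _
    ⟨altFormsPullback_injective W, altFormsPullback_surjective W⟩).finrank_eq, finrank_altForms,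
    Submodule.finrank_quotient]

end AlternatingForms

/-! ### The bound on the dimension of the space of cocycles. -/

section Bound

theorem Submodule.finrank_map_add_finrank_inf_ker {K V W : Type*} [Field K] [AddCommGroup V]
    [Module K V] [FiniteDimensional K V] [AddCommGroup W] [Module K W] (S : Submodule K V)
    (f : V →ₗ[K] W) :
    Module.finrank K (S.map f) + Module.finrank K ↥(S ⊓ LinearMap.ker f) =
      Module.finrank K S := by
  rw [← LinearMap.finrank_range_add_finrank_ker (f.domRestrict S), LinearMap.range_domRestrict,
    LinearMap.ker_domRestrict, ← Submodule.map_comap_subtype,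
    Submodule.finrank_map_subtype_eq]

variable {K L : Type*} [Field K] [LieRing L] [LieAlgebra K L]

variable (K L) in
/-- The derived subalgebra, as a subspace. -/
abbrev derivedSubspace : Submodule K L :=
  (⁅(⊤ : LieIdeal K L), (⊤ : LieIdeal K L)⁆).toSubmodule

theorem lie_mem_derivedSubspace (x y : L) : ⁅x, y⁆ ∈ derivedSubspace K L :=
  LieSubmodule.lie_mem_lie (LieSubmodule.mem_top x) (LieSubmodule.mem_top y)

theorem derivedSubspace_le_iff {I : Submodule K L} :
    derivedSubspace K L ≤ I ↔ ∀ x y : L, ⁅x, y⁆ ∈ I := by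
  refine ⟨fun h x y => h (lie_mem_derivedSubspace x y), fun h => ?_⟩
  rw [derivedSubspace, LieSubmodule.lieIdeal_oper_eq_linear_span', Submodule.span_le]
  rintro _ ⟨x, -, y, -, rfl⟩
  exact h x y

/-- The 2-cocycles with `I` in the radical. -/
abbrev cocyclesVanishingOn (I : Submodule K L) : Submodule K (L →ₗ[K] L →ₗ[K] K) :=
  trivialTwoCocycles K L ⊓ altFormsVanishingOn I

theorem cocyclesVanishingOn_bot :
    cocyclesVanishingOn (⊥ : Submodule K L) = trivialTwoCocycles K L :=
  inf_eq_left.mpr fun ω hω => ⟨hω.1, fun w hw => by rw [(Submodule.mem_bot K).mp hw, map_zero]⟩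

theorem cocyclesVanishingOn_derivedSubspace :
    cocyclesVanishingOn (derivedSubspace K L) = altFormsVanishingOn (derivedSubspace K L) :=
  inf_eq_right.mpr fun ω hω => ⟨hω.1, fun x y z => by
    simp [hω.2 _ (lie_mem_derivedSubspace _ _)]⟩

theorem mem_cocyclesVanishingOn_sup_span {I : Submodule K L} {v : L}
    {ω : L →ₗ[K] L →ₗ[K] K} (hω : ω ∈ cocyclesVanishingOn I) (hv : ω v = 0) :
    ω ∈ cocyclesVanishingOn (I ⊔ Submodule.span K {v}) := by
  refine ⟨hω.1, hω.1.1, fun w hw => ?_⟩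
  obtain ⟨i, hi, _, hj, rfl⟩ := Submodule.mem_sup.mp hw
  obtain ⟨t, rfl⟩ := Submodule.mem_span_singleton.mp hj
  rw [map_add, map_smul, hv, smul_zero, add_zero, hω.2.2 i hi]

/-- Nilpotency provides elements of `L²` outside `I` that are central modulo `I`. -/
theorem exists_mem_derivedSubspace_central_mod [LieRing.IsNilpotent L] {I : Submodule K L}
    (hI : ¬ derivedSubspace K L ≤ I) :
    ∃ v ∈ derivedSubspace K L, v ∉ I ∧ ∀ z : L, ⁅z, v⁆ ∈ I := by
  classical
  obtain ⟨N, hN⟩ := LieModule.IsNilpotent.nilpotent K L L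
  have hex : ∃ k, (LieModule.lowerCentralSeries K L L (k + 1)).toSubmodule ≤ I :=
    ⟨N, by
      have := LieModule.antitone_lowerCentralSeries K L L N.le_succ
      rw [hN, le_bot_iff] at this
      rw [this]
      exact bot_le⟩
  have hspec := Nat.find_spec hex
  rcases hk : Nat.find hex with _ | k
  · rw [hk, zero_add, LieModule.lowerCentralSeries_succ, LieModule.lowerCentralSeries_zero] at hspec
    exact absurd hspec hI
  -- The term of index k + 2 is the first in I, so any v outside I in the term of index k + 1 works;
  -- that term lies in L², which has index 1.
  · have hmin := Nat.find_min hex (m := k) (by omega)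
    rw [hk] at hspec
    obtain ⟨v, hv, hvI⟩ := Set.not_subset.mp hmin
    refine ⟨v, LieModule.antitone_lowerCentralSeries K L L (Nat.le_add_left 1 k) hv, hvI,
      fun z => hspec ?_⟩
    rw [LieModule.lowerCentralSeries_succ K L L (k + 1)]
    exact LieSubmodule.lie_mem_lie (LieSubmodule.mem_top z) hv

theorem lie_mem_symm {I : Submodule K L} {v : L} (h : ∀ z : L, ⁅z, v⁆ ∈ I) (z : L) : ⁅v, z⁆ ∈ I := by
  rw [← lie_skew]
  exact I.neg_mem (h z)

/-- Evaluation of bilinear forms at the pairs `(v, x)` and `(v, y)`. -/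
def evalPair (v x y : L) : (L →ₗ[K] L →ₗ[K] K) →ₗ[K] K × K :=
  (LinearMap.applyₗ x ∘ₗ LinearMap.applyₗ v).prod (LinearMap.applyₗ y ∘ₗ LinearMap.applyₗ v)

theorem evalPair_apply (v x y : L) (ω : L →ₗ[K] L →ₗ[K] K) :
    evalPair v x y ω = (ω v x, ω v y) := rfl

/-- Modulo I every bracket is a multiple of [x,y]. If ω([x,y],·) vanishes at x and y, the identity
on (x, y, z) therefore reduces to ω([x,y],z) = 0. -/
theorem cocyclesVanishingOn_inf_ker_evalPair {I : Submodule K L} {x y : L}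
    (h : derivedSubspace K L = I ⊔ Submodule.span K {⁅x, y⁆}) :
    cocyclesVanishingOn I ⊓ LinearMap.ker (evalPair ⁅x, y⁆ x y) =
      altFormsVanishingOn (derivedSubspace K L) := by
  refine le_antisymm ?_ ?_
  · rintro ω ⟨hω, hker⟩
    replace hker := Prod.mk_eq_zero.mp (LinearMap.mem_ker.mp hker)
    have hlie (p q r : L) (hr : ω ⁅x, y⁆ r = 0) : ω ⁅p, q⁆ r = 0 := by
      have hpq := lie_mem_derivedSubspace (K := K) p q
      rw [h] at hpq
      obtain ⟨i, hi, _, hj, hij⟩ := Submodule.mem_sup.mp hpq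
      obtain ⟨t, rfl⟩ := Submodule.mem_span_singleton.mp hj
      rw [← hij, map_add, map_smul, LinearMap.add_apply, LinearMap.smul_apply, hω.2.2 i hi, hr]
      simp
    rw [← cocyclesVanishingOn_derivedSubspace, h]
    refine mem_cocyclesVanishingOn_sup_span hω (LinearMap.ext fun z => ?_)
    have := hω.1.2 x y z
    rwa [hlie y z x hker.1, hlie z x y hker.2, add_zero, add_zero] at this
  · intro ω hω
    refine ⟨⟨?_, hω.1, fun w hw => hω.2 w (h ▸ Submodule.mem_sup_left hw)⟩, ?_⟩
    · rw [← cocyclesVanishingOn_derivedSubspace] at hω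
      exact hω.1
    · refine LinearMap.mem_ker.mpr ?_
      rw [evalPair_apply, hω.2 _ (lie_mem_derivedSubspace x y)]
      rfl

variable [FiniteDimensional K L]

/-- Apply rank-nullity to ω ↦ ω(v,·). In the identity on (x, y, v) the terms containing [y,v] and
[v,x] vanish, so the image lies in the annihilator of L². -/
theorem finrank_cocyclesVanishingOn_le_add {I : Submodule K L} {v : L} (hvI : ∀ z : L, ⁅z, v⁆ ∈ I) :
    Module.finrank K (cocyclesVanishingOn I) ≤
      Module.finrank K L - Module.finrank K (derivedSubspace K L) +
        Module.finrank K (cocyclesVanishingOn (I ⊔ Submodule.span K {v})) := by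
  set f : (L →ₗ[K] L →ₗ[K] K) →ₗ[K] Module.Dual K L := LinearMap.applyₗ v
  have h0 := Submodule.finrank_map_add_finrank_inf_ker (K := K) (V := L →ₗ[K] L →ₗ[K] K)
    (W := Module.Dual K L) (cocyclesVanishingOn I) f
  have h1 : (cocyclesVanishingOn I).map f ≤ (derivedSubspace K L).dualAnnihilator := by
    rintro _ ⟨ω, hω, rfl⟩
    rw [Submodule.mem_dualAnnihilator]
    change derivedSubspace K L ≤ LinearMap.ker (ω v)
    rw [derivedSubspace_le_iff]
    intro x y
    have h := hω.1.2 x y v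
    rw [hω.2.2 _ (hvI y), hω.2.2 _ (lie_mem_symm hvI x), LinearMap.zero_apply,
      LinearMap.zero_apply, add_zero, add_zero,
      LinearMap.skew_of_apply_self_eq_zero hω.1.1, neg_eq_zero] at h
    exact h
  have h2 : cocyclesVanishingOn I ⊓ LinearMap.ker f ≤
      cocyclesVanishingOn (I ⊔ Submodule.span K {v}) :=
    fun ω hω => mem_cocyclesVanishingOn_sup_span hω.1 hω.2
  have h3 := Subspace.finrank_add_finrank_dualAnnihilator_eq (derivedSubspace K L)
  have h4 := Submodule.finrank_mono h1
  have h5 := Submodule.finrank_mono h2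
  omega

theorem finrank_cocyclesVanishingOn_eq {I : Submodule K L} {x y : L}
    (h : derivedSubspace K L = I ⊔ Submodule.span K {⁅x, y⁆}) :
    Module.finrank K (cocyclesVanishingOn I) =
      Module.finrank K ((cocyclesVanishingOn I).map (evalPair ⁅x, y⁆ x y)) +
      (Module.finrank K L - Module.finrank K (derivedSubspace K L)).choose 2 := by
  have := Submodule.finrank_map_add_finrank_inf_ker (K := K) (V := L →ₗ[K] L →ₗ[K] K)
    (W := K × K) (cocyclesVanishingOn I) (evalPair ⁅x, y⁆ x y)
  rw [cocyclesVanishingOn_inf_ker_evalPair h, finrank_altFormsVanishingOn] at this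
  exact this.symm

theorem sup_span_singleton_eq_of_finrank_eq {I J : Submodule K L} {v : L} (hIJ : I ≤ J)
    (hvJ : v ∈ J) (hvI : v ∉ I) (h : Module.finrank K I + 1 = Module.finrank K J) :
    J = I ⊔ Submodule.span K {v} := by
  refine (Submodule.eq_of_le_of_finrank_le
    (sup_le hIJ ((Submodule.span_singleton_le_iff_mem v J).mpr hvJ)) ?_).symm
  have hlt : I < I ⊔ Submodule.span K {v} := left_lt_sup.mpr
    fun hle => hvI ((Submodule.span_singleton_le_iff_mem v I).mp hle)
  have := Submodule.finrank_lt_finrank_of_lt hlt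
  omega

theorem exists_lie_notMem {I : Submodule K L}
    (hI : Module.finrank K I < Module.finrank K (derivedSubspace K L)) :
    ∃ x y : L, ⁅x, y⁆ ∉ I := by
  by_contra! h
  exact (Submodule.finrank_mono (derivedSubspace_le_iff.mpr h)).not_gt hI

/-- Induction on codimension, stopping at codimension 1, where the two evaluations replace the
weaker estimate n-m. I need not be an ideal: only centrality of the added vector modulo I enters. -/
theorem finrank_cocyclesVanishingOn_le [LieRing.IsNilpotent L] (d : ℕ) (I : Submodule K L)
    (hI : I ≤ derivedSubspace K L)
    (hd : Module.finrank K I + (d + 1) = Module.finrank K (derivedSubspace K L)) :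
    Module.finrank K (cocyclesVanishingOn I) ≤
      d * (Module.finrank K L - Module.finrank K (derivedSubspace K L)) + (2 +
      (Module.finrank K L - Module.finrank K (derivedSubspace K L)).choose 2) := by
  induction d generalizing I with
  | zero =>
    obtain ⟨x, y, hxy⟩ := exists_lie_notMem (I := I) (by omega)
    rw [finrank_cocyclesVanishingOn_eq (sup_span_singleton_eq_of_finrank_eq hI
      (lie_mem_derivedSubspace x y) hxy (by omega))]
    have := Submodule.finrank_le ((cocyclesVanishingOn I).map (evalPair ⁅x, y⁆ x y))
    rw [Module.finrank_prod, Module.finrank_self] at this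
    omega
  | succ d ih =>
    obtain ⟨v, hv, hvI, hz⟩ := exists_mem_derivedSubspace_central_mod (I := I)
      fun hle => by have := Submodule.finrank_mono hle; omega
    have hlt : I < I ⊔ Submodule.span K {v} := left_lt_sup.mpr
      fun hle => hvI ((Submodule.span_singleton_le_iff_mem v I).mp hle)
    have h1 := Submodule.finrank_lt_finrank_of_lt hlt
    have h2 := Submodule.finrank_add_le_finrank_add_finrank I (Submodule.span K {v})
    have h3 := finrank_span_singleton (K := K) (v := v) (fun h0 => hvI (h0 ▸ I.zero_mem))
    have h4 := ih (I ⊔ Submodule.span K {v})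
      (sup_le hI ((Submodule.span_singleton_le_iff_mem v _).mpr hv)) (by omega)
    have h5 := finrank_cocyclesVanishingOn_le_add hz
    rw [add_mul, one_mul]
    omega

theorem finrank_trivialTwoCocycles_le [LieRing.IsNilpotent L]
    (h : 1 ≤ Module.finrank K (derivedSubspace K L)) :
    Module.finrank K (trivialTwoCocycles K L) ≤
      (Module.finrank K (derivedSubspace K L) - 1) *
        (Module.finrank K L - Module.finrank K (derivedSubspace K L)) + (2 +
      (Module.finrank K L - Module.finrank K (derivedSubspace K L)).choose 2) := by
  rw [← cocyclesVanishingOn_bot]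
  exact finrank_cocyclesVanishingOn_le _ ⊥ bot_le (by rw [finrank_bot]; omega)

end Bound

/-! ### Splitting off H(1), and the extremal cocycles. -/

section HeisenbergSplitting

variable {K : Type u} {L : Type v} [Field K] [LieRing L] [LieAlgebra K L]

/-- Coordinates that exhibit `L` as the sum of a Heisenberg algebra with basis `x, y, v` and an
abelian algebra. -/
structure HeisenbergCoordinates (α β γ : Module.Dual K L) (x y v : L) : Prop where
  alpha_x : α x = 1
  alpha_y : α y = 0
  alpha_v : α v = 0
  beta_x : β x = 0
  beta_y : β y = 1
  beta_v : β v = 0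
  gamma_x : γ x = 0
  gamma_y : γ y = 0
  gamma_v : γ v = 1
  lie_eq : ∀ z w : L, ⁅z, w⁆ = (α z * β w - β z * α w) • v

namespace HeisenbergCoordinates

variable {α β γ : Module.Dual K L} {x y v : L}

/-- The abelian complement of the Heisenberg algebra. -/
def complement (h : HeisenbergCoordinates α β γ x y v) : LieSubalgebra K L where
  toSubmodule := LinearMap.ker α ⊓ LinearMap.ker β ⊓ LinearMap.ker γ
  lie_mem' {z w} hz hw := by
    have h1 : α z = 0 := hz.1.1
    have h2 : β z = 0 := hz.1.2
    rw [h.lie_eq, h1, h2]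
    simp

theorem alpha_complement (h : HeisenbergCoordinates α β γ x y v) (z : h.complement) :
    α z = 0 := z.2.1.1

theorem beta_complement (h : HeisenbergCoordinates α β γ x y v) (z : h.complement) :
    β z = 0 := z.2.1.2

theorem gamma_complement (h : HeisenbergCoordinates α β γ x y v) (z : h.complement) :
    γ z = 0 := z.2.2

theorem isLieAbelian_complement (h : HeisenbergCoordinates α β γ x y v) :
    IsLieAbelian h.complement where
  trivial z w := by
    ext
    simp [h.lie_eq, h.alpha_complement, h.beta_complement]

/-- The splitting of `L` given by the coordinates. -/
def lieEquiv (h : HeisenbergCoordinates α β γ x y v) :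
    L ≃ₗ⁅K⁆ HeisenbergAlgebra K 1 × h.complement where
  -- The second component is the projection onto the common kernel of α, β, γ along the span of x,
  -- y, v.
  toFun z := (⟨fun _ => α z, fun _ => β z, γ z⟩, ⟨z - α z • x - β z • y - γ z • v,
    ⟨by simp [h.alpha_x, h.alpha_y, h.alpha_v], by simp [h.beta_x, h.beta_y, h.beta_v]⟩,
    by simp [h.gamma_x, h.gamma_y, h.gamma_v]⟩)
  map_add' z w := by
    ext <;> simp
    module
  map_smul' t z := by
    ext <;> simp
    module
  map_lie' {z w} := by
    have := h.isLieAbelian_complement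
    refine Prod.ext ?_ (Subtype.ext ?_)
    · ext <;> simp [h.lie_eq, h.alpha_v, h.beta_v, h.gamma_v]
    · rw [LieAlgebra.Prod.bracket_apply, trivial_lie_zero h.complement h.complement]
      simp [h.lie_eq, h.alpha_v, h.beta_v, h.gamma_v]
  invFun p := p.1.a 0 • x + p.1.b 0 • y + p.1.c • v + p.2
  left_inv z := by
    simp
  right_inv p := by
    ext i
    · fin_cases i
      simp [h.alpha_x, h.alpha_y, h.alpha_v, h.alpha_complement]
    · fin_cases i
      simp [h.beta_x, h.beta_y, h.beta_v, h.beta_complement]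
    · simp [h.gamma_x, h.gamma_y, h.gamma_v, h.gamma_complement]
    · simp [h.alpha_x, h.alpha_y, h.alpha_v, h.alpha_complement, h.beta_x, h.beta_y, h.beta_v,
        h.beta_complement, h.gamma_x, h.gamma_y, h.gamma_v, h.gamma_complement]
      abel

/-- The alternating form `γ ∧ (s α + t β)`. -/
def wedge (α β γ : Module.Dual K L) (s t : K) : L →ₗ[K] L →ₗ[K] K :=
  LinearMap.mk₂ K (fun z w => γ z * (s * α w + t * β w) - (s * α z + t * β z) * γ w)
    (fun _ _ _ => by simp; ring) (fun _ _ _ => by simp; ring)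
    (fun _ _ _ => by simp; ring) (fun _ _ _ => by simp; ring)

theorem wedge_apply (s t : K) (z w : L) : wedge α β γ s t z w =
    γ z * (s * α w + t * β w) - (s * α z + t * β z) * γ w := rfl

/-- With δ = sα + tβ the form sends (v, r) to δ(r), so the cyclic sum is α∧β∧δ, which is 0. -/
theorem wedge_mem (h : HeisenbergCoordinates α β γ x y v) (s t : K) :
    wedge α β γ s t ∈ trivialTwoCocycles K L := by
  refine ⟨fun z => ?_, fun z w r => ?_⟩
  · rw [wedge_apply]
    ring
  · simp only [wedge_apply, h.lie_eq, map_smul, LinearMap.smul_apply, smul_eq_mul, h.alpha_v, h.beta_v, h.gamma_v]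
    ring

theorem lie_x_y (h : HeisenbergCoordinates α β γ x y v) : ⁅x, y⁆ = v := by
  simp [h.lie_eq, h.alpha_x, h.beta_y, h.beta_x]

theorem map_evalPair_eq_top (h : HeisenbergCoordinates α β γ x y v) :
    (trivialTwoCocycles K L).map (evalPair ⁅x, y⁆ x y) = ⊤ := by
  rw [eq_top_iff]
  rintro ⟨s, t⟩ -
  refine ⟨_, h.wedge_mem s t, ?_⟩
  rw [evalPair_apply, h.lie_x_y]
  simp [wedge_apply, h.alpha_x, h.alpha_y, h.alpha_v, h.beta_x, h.beta_y, h.beta_v, h.gamma_x, h.gamma_y,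
    h.gamma_v]

theorem derivedSubspace_eq (h : HeisenbergCoordinates α β γ x y v) :
    derivedSubspace K L = ⊥ ⊔ Submodule.span K {⁅x, y⁆} := by
  rw [bot_sup_eq, h.lie_x_y]
  refine le_antisymm (derivedSubspace_le_iff.mpr fun z w => ?_) ?_
  · rw [h.lie_eq]
    exact Submodule.smul_mem _ _ (Submodule.mem_span_singleton_self v)
  · rw [Submodule.span_singleton_le_iff_mem, ← h.lie_x_y]
    exact lie_mem_derivedSubspace x y

end HeisenbergCoordinates

theorem exists_heisenbergCoordinates_of_map_evalPair {x y : L} (hne : ⁅x, y⁆ ≠ 0)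
    (hD : derivedSubspace K L = ⊥ ⊔ Submodule.span K {⁅x, y⁆})
    (htop : (trivialTwoCocycles K L).map (evalPair ⁅x, y⁆ x y) = ⊤) :
    ∃ α β γ : Module.Dual K L, HeisenbergCoordinates α β γ x y ⁅x, y⁆ := by
  obtain ⟨f, hf⟩ : ∃ f : Module.Dual K L, f ⁅x, y⁆ ≠ 0 := by
    by_contra! hf
    exact hne ((Module.forall_dual_apply_eq_zero_iff K _).mp hf)
  obtain ⟨g, hg⟩ : ∃ g : Module.Dual K L, g ⁅x, y⁆ = 1 :=
    ⟨(f ⁅x, y⁆)⁻¹ • f, by simp [hf]⟩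
  have hlie (z w : L) : ⁅z, w⁆ = g ⁅z, w⁆ • ⁅x, y⁆ := by
    have hzw := lie_mem_derivedSubspace (K := K) z w
    rw [hD, bot_sup_eq] at hzw
    obtain ⟨t, ht⟩ := Submodule.mem_span_singleton.mp hzw
    rw [← ht, map_smul, hg, smul_eq_mul, mul_one]
  have hcoc {η : L →ₗ[K] L →ₗ[K] K} (hη : η ∈ trivialTwoCocycles K L) (z w r : L) :
      g ⁅z, w⁆ * η ⁅x, y⁆ r + g ⁅w, r⁆ * η ⁅x, y⁆ z + g ⁅r, z⁆ * η ⁅x, y⁆ w = 0 := by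
    have h := hη.2 z w r
    rw [hlie z w, hlie w r, hlie r z] at h
    simpa using h
  have hskew (z w : L) : g ⁅z, w⁆ = -g ⁅w, z⁆ := by rw [← lie_skew, map_neg]
  obtain ⟨ω, hω, hω'⟩ : ((1 : K), (0 : K)) ∈ (trivialTwoCocycles K L).map (evalPair ⁅x, y⁆ x y) :=
    htop ▸ Submodule.mem_top
  obtain ⟨η, hη, hη'⟩ : ((0 : K), (1 : K)) ∈ (trivialTwoCocycles K L).map (evalPair ⁅x, y⁆ x y) :=
    htop ▸ Submodule.mem_top
  obtain ⟨hωx, hωy⟩ := Prod.mk.inj hω'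
  obtain ⟨hηx, hηy⟩ := Prod.mk.inj hη'
  change ω ⁅x, y⁆ x = 1 at hωx
  change ω ⁅x, y⁆ y = 0 at hωy
  change η ⁅x, y⁆ x = 0 at hηx
  change η ⁅x, y⁆ y = 1 at hηy
  -- The correction of g makes γ vanish at x and y; it keeps the value 1 at [x,y], where ω([x,y],·)
  -- and η([x,y],·) are zero.
  refine ⟨ω ⁅x, y⁆, η ⁅x, y⁆, g - g x • ω ⁅x, y⁆ - g y • η ⁅x, y⁆, hωx, hωy, hω.1 _, hηx, hηy,
    hη.1 _, by simp [hωx, hηx], by simp [hωy, hηy], by simp [hω.1, hη.1, hg], fun z w => ?_⟩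
  -- The identity for η on (x, y, r) computes brackets with x; the one for ω on (z, w, x) then
  -- expresses [z,w] through them.
  have hβ (r : L) : g ⁅r, x⁆ = -η ⁅x, y⁆ r := by
    have h := hcoc hη x y r
    rw [hg, hηx, hηy] at h
    linear_combination h
  have h := hcoc hω z w x
  rw [hωx, hβ, hskew x z, hβ] at h
  rw [hlie z w]
  congr 1
  linear_combination h

theorem exists_heisenbergCoordinates_of_lieEquiv {A : Type v} [LieRing A] [LieAlgebra K A]
    [IsLieAbelian A] (e : L ≃ₗ⁅K⁆ HeisenbergAlgebra K 1 × A) :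
    ∃ (α β γ : Module.Dual K L) (x y v : L), HeisenbergCoordinates α β γ x y v := by
  let a : Module.Dual K L :=
    { toFun z := (e z).1.a 0, map_add' _ _ := by simp, map_smul' _ _ := by simp }
  let b : Module.Dual K L :=
    { toFun z := (e z).1.b 0, map_add' _ _ := by simp, map_smul' _ _ := by simp }
  let c : Module.Dual K L :=
    { toFun z := (e z).1.c, map_add' _ _ := by simp, map_smul' _ _ := by simp }
  have ha (z : L) : a z = (e z).1.a 0 := rfl
  have hb (z : L) : b z = (e z).1.b 0 := rfl
  have hc (z : L) : c z = (e z).1.c := rfl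
  refine ⟨a, b, c, e.symm (⟨1, 0, 0⟩, 0), e.symm (⟨0, 1, 0⟩, 0), e.symm (⟨0, 0, 1⟩, 0), ?_⟩
  constructor
  case lie_eq =>
    intro z w
    rw [← e.symm_apply_apply ⁅z, w⁆, ← map_smul]
    congr 1
    have hzw : e ⁅z, w⁆ = ⁅e z, e w⁆ := e.toLieHom.map_lie z w
    rw [hzw, LieAlgebra.Prod.bracket_apply, trivial_lie_zero A A]
    ext <;> simp [ha, hb]
  all_goals simp [ha, hb, hc]

theorem finrank_heisenbergAlgebra_one : Module.finrank K (HeisenbergAlgebra K 1) = 3 := by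
  let e : HeisenbergAlgebra K 1 ≃ₗ[K] (Fin 1 → K) × (Fin 1 → K) × K :=
    { HeisenbergAlgebra.equivProd K 1 with
      map_add' _ _ := rfl
      map_smul' _ _ := rfl }
  rw [e.finrank_eq]
  simp

theorem finiteDimensional_heisenbergAlgebra_one :
    FiniteDimensional K (HeisenbergAlgebra K 1) :=
  Module.finite_of_finrank_pos (by rw [finrank_heisenbergAlgebra_one]; norm_num)

end HeisenbergSplitting

/-! ### The equality case and the final count. -/

section Main

variable {K : Type u} {L : Type v} [Field K] [LieRing L] [LieAlgebra K L]

theorem HeisenbergCoordinates.finrank_complement [FiniteDimensional K L]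
    {α β γ : Module.Dual K L} {x y v : L} (h : HeisenbergCoordinates α β γ x y v) :
    Module.finrank K L = 3 + Module.finrank K h.complement := by
  have := finiteDimensional_heisenbergAlgebra_one (K := K)
  have hcomp : FiniteDimensional K h.complement :=
    inferInstanceAs (FiniteDimensional K h.complement.toSubmodule)
  rw [h.lieEquiv.toLinearEquiv.finrank_eq, Module.finrank_prod, finrank_heisenbergAlgebra_one]

/-- If `L²` is spanned by `⁅x, y⁆`, the space of 2-cocycles has the maximal dimension exactly when
the cocycles take all pairs of values at `(⁅x, y⁆, x)` and `(⁅x, y⁆, y)`. -/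
theorem finrank_trivialTwoCocycles_eq_iff [FiniteDimensional K L] {m : ℕ}
    (hm : Module.finrank K (derivedSubspace K L) = m) {x y : L}
    (hD : derivedSubspace K L = ⊥ ⊔ Submodule.span K {⁅x, y⁆}) :
    Module.finrank K (trivialTwoCocycles K L) =
        2 + (Module.finrank K L - m).choose 2 ↔
      (trivialTwoCocycles K L).map (evalPair ⁅x, y⁆ x y) = ⊤ := by
  have h := finrank_cocyclesVanishingOn_eq hD
  rw [cocyclesVanishingOn_bot] at h
  have h2 : Module.finrank K (K × K) = 2 := by
    rw [Module.finrank_prod, Module.finrank_self]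
  rw [h, hm, add_left_inj]
  constructor
  · intro h3
    exact Submodule.eq_top_of_finrank_eq (h3.trans h2.symm)
  · intro h3
    rw [h3, finrank_top, h2]

theorem finrank_trivialTwoCocycles_eq_iff_exists_heisenberg [FiniteDimensional K L]
    (hm : Module.finrank K (derivedSubspace K L) = 1) :
    Module.finrank K (trivialTwoCocycles K L) = 2 + (Module.finrank K L - 1).choose 2 ↔
      ∃ (A : Type v) (_ : LieRing A) (_ : LieAlgebra K A), IsLieAbelian A ∧
        FiniteDimensional K A ∧ (Module.finrank K A : ℤ) = (Module.finrank K L : ℤ) - 3 ∧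
          Nonempty (L ≃ₗ⁅K⁆ HeisenbergAlgebra K 1 × A) := by
  constructor
  · intro heq
    obtain ⟨x, y, hxy⟩ := exists_lie_notMem (K := K) (L := L) (I := ⊥)
      (by rw [finrank_bot, hm]; exact one_pos)
    have hD := sup_span_singleton_eq_of_finrank_eq bot_le (lie_mem_derivedSubspace x y) hxy
      (by rw [finrank_bot, hm])
    obtain ⟨α, β, γ, h⟩ := exists_heisenbergCoordinates_of_map_evalPair hxy hD
      ((finrank_trivialTwoCocycles_eq_iff hm hD).mp heq)
    refine ⟨h.complement, inferInstance, inferInstance, h.isLieAbelian_complement,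
      inferInstanceAs (FiniteDimensional K h.complement.toSubmodule), ?_, ⟨h.lieEquiv⟩⟩
    have := h.finrank_complement
    omega
  · rintro ⟨A, _, _, hA, -, -, ⟨e⟩⟩
    obtain ⟨α, β, γ, x, y, v, h⟩ := exists_heisenbergCoordinates_of_lieEquiv e
    exact (finrank_trivialTwoCocycles_eq_iff hm h.derivedSubspace_eq).mpr h.map_evalPair_eq_top

end Main

theorem theorem3p1 {K : Type u} {L : Type v} [Field K] [LieRing L] [LieAlgebra K L]
    [FiniteDimensional K L] [LieRing.IsNilpotent L] (n m : ℕ)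
    (hn : Module.finrank K L = n)
    (hm : Module.finrank K ↥⁅(⊤ : LieIdeal K L), (⊤ : LieIdeal K L)⁆ = m)
    (hm1 : 1 ≤ m) :
    FiniteDimensional K (SchurMultiplier K L) ∧
    (Module.finrank K (SchurMultiplier K L) : ℚ) ≤
      1 / 2 * ((n : ℚ) + m - 2) * ((n : ℚ) - m - 1) + 1 ∧
    (m = 1 →
      ((Module.finrank K (SchurMultiplier K L) : ℚ) =
          1 / 2 * ((n : ℚ) + m - 2) * ((n : ℚ) - m - 1) + 1 ↔
        ∃ (A : Type v) (_ : LieRing A) (_ : LieAlgebra K A),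
          IsLieAbelian A ∧ FiniteDimensional K A ∧ (Module.finrank K A : ℤ) = (n : ℤ) - 3 ∧
            Nonempty (L ≃ₗ⁅K⁆ HeisenbergAlgebra K 1 × A))) := by
  have hopf := finrank_schurMultiplier_add_finrank_derived (K := K) (L := L)
  rw [hm] at hopf
  have hm' : Module.finrank K (derivedSubspace K L) = m := hm
  have hmn : m ≤ n := by
    rw [← hm', ← hn]
    exact Submodule.finrank_le _
  -- Setting m = d + 1 and n = m + p removes truncated subtraction; the bound becomes dp + 2 +
  -- C(p,2) - (d + 1).
  obtain ⟨p, rfl⟩ := Nat.exists_eq_add_of_le hmn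
  obtain ⟨d, rfl⟩ := Nat.exists_eq_add_of_le' hm1
  have hbound := finrank_trivialTwoCocycles_le (K := K) (L := L) (by omega)
  rw [hm', hn, Nat.add_sub_cancel_left, Nat.add_sub_cancel, ← hopf] at hbound
  refine ⟨finiteDimensional_schurMultiplier, ?_, fun h1 => ?_⟩
  · have h : ((Module.finrank K (SchurMultiplier K L) + (d + 1) : ℕ) : ℚ) ≤
        ((d * p + (2 + p.choose 2) : ℕ) : ℚ) := Nat.cast_le.mpr hbound
    push_cast [Nat.cast_choose_two] at h ⊢
    linarith
  · obtain rfl : d = 0 := by omega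
    rw [← hn, ← finrank_trivialTwoCocycles_eq_iff_exists_heisenberg hm', ← hopf, hn,
      Nat.add_sub_cancel_left, ← Nat.cast_inj (R := ℚ)]
    push_cast [Nat.cast_choose_two]
    constructor <;> intro h <;> linarith
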